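/- Let $n > k \ge r \ge 1$ be integers. An $(n,k,r)$-locally recoverable code ($(n,k,r)$-LRC) is a linear code $C \subseteq \mathbb{F}^n$ of dimension $k$ over a finite field $\mathbb{F}$ such that for every coordinate $i$ there are a set $S$ of at most $r$ coordinates different from $i$ and coefficients $a_j \in \mathbb{F}$ ($j \in S$) with $c_i = \sum_{j\in S} a_j c_j$ for all $c \in C$. Let $\mathscr{D}(n,k,r)$ be the largest minimum (Hamming) distance among all $(n,k,r)$-LRCs, with no restriction on the order of the finite field. Put $$k_1 = \left\lceil \tfrac{k}{r} \right\rceil,\quad k_2 = k_1 r - k,\quad n_1 = \left\lceil \tfrac{n}{r+1} \right\rceil,\quad n_2 = n_1 (r+1) - n,\quad d^* = n - k - \left\lceil \tfrac{k}{r} \right\rceil + 2 .$$ **Theorem.** Suppose $n_1 - k_1 = 1$. Then $\mathscr{D}(n,k,r) = d^*$ if and only if $$n_2 - \left\lfloor \frac{2 n_2}{n_1} \right\rfloor \le k_2 .$$ -/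

import Mathlib

/-- The minimum distance of a linear code `C` of length `n` over `F`: the least Hamming distance
between two distinct codewords. -/
noncomputable def minDistance {F : Type} [Field F] [DecidableEq F] {n : ℕ}
    (C : Submodule F (Fin n → F)) : ℕ :=
  sInf {d : ℕ | ∃ x ∈ C, ∃ y ∈ C, x ≠ y ∧ hammingDist x y = d}

/-- Every coordinate of the code `C` is recovered by a fixed linear combination of at most `r`
other coordinates. -/
def HasLocality {F : Type} [Field F] {n : ℕ} (C : Submodule F (Fin n → F)) (r : ℕ) : Prop :=
  ∀ i : Fin n, ∃ S : Finset (Fin n), i ∉ S ∧ S.card ≤ r ∧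
    ∃ a : Fin n → F, ∀ c ∈ C, c i = ∑ j ∈ S, a j * c j

/-- An `(n, k, r)`-locally recoverable code: a linear code of length `n` and dimension `k` with
all-symbol locality `r`. -/
structure IsLRC {F : Type} [Field F] {n : ℕ} (C : Submodule F (Fin n → F)) (k r : ℕ) : Prop where
  finrank_eq : Module.finrank F C = k
  locality : HasLocality C r

/-- The minimum distances of `(n, k, r)`-locally recoverable codes, over all finite fields. -/
def lrcDistances (n k r : ℕ) : Set ℕ :=
  {d | ∃ (F : Type) (_ : Field F) (_ : Fintype F) (_ : DecidableEq F)
    (C : Submodule F (Fin n → F)), IsLRC C k r ∧ minDistance C = d}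

/-- The largest possible minimum distance of an `(n, k, r)`-locally recoverable code, with no
restriction on the order of the finite field. -/
noncomputable def largestMinDistance (n k r : ℕ) : ℕ :=
  sSup (lrcDistances n k r)

/-- A minimum distance never exceeds the length, so the supremum above is a supremum of a bounded
set of natural numbers. -/
theorem bddAbove_lrcDistances (n k r : ℕ) : BddAbove (lrcDistances n k r) := by
  refine ⟨n, ?_⟩
  rintro d ⟨F, _, _, _, C, -, rfl⟩
  rcases Set.eq_empty_or_nonempty
    {d : ℕ | ∃ x ∈ C, ∃ y ∈ C, x ≠ y ∧ hammingDist x y = d} with h | h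
  · simp [minDistance, h]
  · obtain ⟨x, -, y, -, -, hd⟩ := Nat.sInf_mem h
    rw [minDistance, ← hd]
    simpa using hammingDist_le_card_fintype (x := x) (y := y)

/-- The largest minimum distance is attained as soon as some `(n, k, r)`-locally recoverable code
exists. -/
theorem isGreatest_largestMinDistance {n k r : ℕ} (h : (lrcDistances n k r).Nonempty) :
    IsGreatest (lrcDistances n k r) (largestMinDistance n k r) :=
  ⟨Nat.sSup_mem h (bddAbove_lrcDistances n k r),
    fun _ hd => le_csSup (bddAbove_lrcDistances n k r) hd⟩

/-- `k₁ = ⌈k / r⌉`. -/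
def paramK₁ (k r : ℕ) : ℤ := ⌈(k : ℚ) / (r : ℚ)⌉

/-- `k₂ = k₁ r - k`. -/
def paramK₂ (k r : ℕ) : ℤ := paramK₁ k r * r - k

/-- `n₁ = ⌈n / (r + 1)⌉`. -/
def paramN₁ (n r : ℕ) : ℤ := ⌈(n : ℚ) / ((r : ℚ) + 1)⌉

/-- `n₂ = n₁ (r + 1) - n`. -/
def paramN₂ (n r : ℕ) : ℤ := paramN₁ n r * (r + 1) - n

/-- `d* = n - k - ⌈k / r⌉ + 2`, the Singleton-like upper bound on the minimum distance of an
`(n, k, r)`-locally recoverable code. -/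
def dStar (n k r : ℕ) : ℤ := n - k - ⌈(k : ℚ) / (r : ℚ)⌉ + 2

/-! Write `s = k₁`, `n₁ = s + 1`, `K = k₂`, `N = n₂`; then `d* = r + 3 + K - N`.

Upper bound and necessity: locality covers the coordinates by repair groups of size at most `r + 1`,
irredundantly, so that each has a private point. If `t` of them cover fewer than `k + t` points,
some nonzero word vanishes on `k - 1` points containing the non-private ones, hence also on the `t`
private points, and `d ≤ n - k - t + 1`. For `t = s - 1` this always applies and gives `d ≤ d*`. If
`d = d*`, it must fail for `t = s`: any `s` groups cover at least `k + s` points, so among `s + 1`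
groups each has few points of its own. Since all other covered points are counted at least twice,
this forces `(s + 1) N ≤ (s + 1) K + 2 N`, which is the stated inequality
(`IsLRC.mul_le_of_lt_minDistance`).

Sufficiency: take `s + 1` groups with `N` points lying in two groups, spread evenly, so that each
private part has at most `r + 1 - ⌊2N / (s + 1)⌋ < d* - 1` points. Any `d* - 1` columns of the
parity checks then have rank at least 2, so the kernel words supported there form a space of
dimension at most `d* - 3`. A generic `k`-dimensional subspace of the kernel avoids all these spaces
(`exists_isLRC_of_groups`). -/

/-! ### Repair groups and irredundant covers -/

theorem minDistance_le_hammingNorm {F : Type} [Field F] [DecidableEq F] {n : ℕ}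
    {C : Submodule F (Fin n → F)} {c : Fin n → F} (hc : c ∈ C) (h0 : c ≠ 0) :
    minDistance C ≤ hammingNorm c :=
  Nat.sInf_le ⟨c, hc, 0, C.zero_mem, h0, hammingDist_zero_right c⟩

theorem le_minDistance {F : Type} [Field F] [DecidableEq F] {n d : ℕ}
    {C : Submodule F (Fin n → F)} (hC : C ≠ ⊥)
    (h : ∀ c ∈ C, c ≠ 0 → d ≤ hammingNorm c) : d ≤ minDistance C := by
  obtain ⟨c, hc, h0⟩ := C.ne_bot_iff.mp hC
  refine le_csInf ⟨_, c, hc, 0, C.zero_mem, h0, rfl⟩ ?_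
  rintro _ ⟨x, hx, y, hy, hxy, rfl⟩
  rw [hammingDist_comm, hammingDist_eq_hammingNorm, neg_add_eq_sub]
  exact h _ (C.sub_mem hx hy) (sub_ne_zero.mpr hxy)

/-- A code of dimension larger than `#V` has a nonzero codeword vanishing on `V`. -/
theorem exists_codeword_vanishing {F : Type} [Field F] {n : ℕ} (C : Submodule F (Fin n → F))
    (V : Finset (Fin n)) (hV : V.card < Module.finrank F C) :
    ∃ c ∈ C, c ≠ 0 ∧ ∀ i ∈ V, c i = 0 := by
  let f : C →ₗ[F] (V → F) := (LinearMap.funLeft F F (fun i : V => (i : Fin n))) ∘ₗ C.subtype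
  have hlt : Module.finrank F (V → F) < Module.finrank F C := by simpa using hV
  have hker := LinearMap.ker_ne_bot_of_finrank_lt (f := f) hlt
  obtain ⟨⟨c, hc⟩, hc', h0⟩ := (Submodule.ne_bot_iff _).mp hker
  refine ⟨c, hc, fun h => h0 (Subtype.ext h), fun i hi => ?_⟩
  exact congrFun (LinearMap.mem_ker.mp hc') ⟨i, hi⟩

/-- `G` is a repair group of `C`: a codeword vanishing on all of `G` except possibly one
coordinate vanishes there as well. -/
def IsRepairGroup {F : Type} [Field F] {n : ℕ} (C : Submodule F (Fin n → F))
    (G : Finset (Fin n)) : Prop :=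
  ∀ p ∈ G, ∀ c ∈ C, (∀ j ∈ G, j ≠ p → c j = 0) → c p = 0

/-- Discarding the zero coefficients makes the recovery relation solvable for each of its
coordinates, not only for `i`. -/
theorem HasLocality.exists_isRepairGroup {F : Type} [Field F] {n r : ℕ}
    {C : Submodule F (Fin n → F)} (h : HasLocality C r) (i : Fin n) :
    ∃ G : Finset (Fin n), i ∈ G ∧ G.card ≤ r + 1 ∧ IsRepairGroup C G := by
  classical
  obtain ⟨S, hi, hS, a, ha⟩ := h i
  refine ⟨insert i (S.filter (fun j => a j ≠ 0)), Finset.mem_insert_self _ _, ?_, ?_⟩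
  · exact (Finset.card_insert_le _ _).trans
      (Nat.succ_le_succ ((Finset.card_filter_le _ _).trans hS))
  · intro p hp c hc hz
    have hsum := ha c hc
    rcases Finset.mem_insert.mp hp with rfl | hp
    · rw [hsum]
      refine Finset.sum_eq_zero fun j hj => ?_
      by_cases haj : a j = 0
      · simp [haj]
      · rw [hz j (by simp [hj, haj]) (fun e => hi (e ▸ hj)), mul_zero]
    · obtain ⟨hpS, hap⟩ := Finset.mem_filter.mp hp
      have hip : i ≠ p := fun e => hi (e ▸ hpS)
      rw [hz i (Finset.mem_insert_self _ _) hip, Finset.sum_eq_single_of_mem p hpS] at hsum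
      · exact (mul_eq_zero.mp hsum.symm).resolve_left hap
      · intro j hj hjp
        by_cases haj : a j = 0
        · simp [haj]
        · rw [hz j (by simp [hj, haj]) hjp, mul_zero]

/-- A cover of the coordinates by sets satisfying `P` contains a cover in which each set has an
element belonging to no other set. -/
theorem exists_irredundant_cover {α : Type} [Fintype α] [DecidableEq α] (P : Finset α → Prop)
    (h : ∀ i, ∃ G, i ∈ G ∧ P G) :
    ∃ T : Finset (Finset α), (∀ G ∈ T, P G) ∧ (∀ i, ∃ G ∈ T, i ∈ G) ∧
      ∀ G ∈ T, ∃ p ∈ G, ∀ G' ∈ T, p ∈ G' → G' = G := by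
  classical
  let Q : Finset (Finset α) → Prop := fun T => (∀ G ∈ T, P G) ∧ ∀ i, ∃ G ∈ T, i ∈ G
  have hQ : Q (Finset.univ.filter P) := by
    refine ⟨fun G hG => (Finset.mem_filter.mp hG).2, fun i => ?_⟩
    obtain ⟨G, hi, hG⟩ := h i
    exact ⟨G, by simp [hG], hi⟩
  obtain ⟨T, -, hT⟩ := exists_minimal_le_of_wellFoundedLT Q _ hQ
  refine ⟨T, hT.prop.1, hT.prop.2, fun G hG => ?_⟩
  by_contra! hp
  have hE : Q (T.erase G) := by
    refine ⟨fun G' hG' => hT.prop.1 _ (Finset.mem_of_mem_erase hG'), fun i => ?_⟩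
    obtain ⟨G', hG', hi⟩ := hT.prop.2 i
    by_cases e : G' = G
    · subst e
      obtain ⟨G'', h1, h2, h3⟩ := hp i hi
      exact ⟨G'', Finset.mem_erase.mpr ⟨h3, h1⟩, h2⟩
    · exact ⟨G', Finset.mem_erase.mpr ⟨e, hG'⟩, hi⟩
  exact Finset.notMem_erase G T (hT.le_of_le hE (Finset.erase_subset _ _) hG)

/-- If `t` irredundant repair groups cover fewer than `k + t` coordinates, the minimum distance is
at most `n - k - t + 1`. -/
theorem minDistance_add_le_of_repairGroups {F : Type} [Field F] [DecidableEq F] {n k : ℕ}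
    {C : Submodule F (Fin n → F)} (hk : Module.finrank F C = k) (hk0 : 1 ≤ k)
    (T : Finset (Finset (Fin n))) (hT : ∀ G ∈ T, IsRepairGroup C G)
    (hp : ∀ G ∈ T, ∃ p ∈ G, ∀ G' ∈ T, p ∈ G' → G' = G)
    (hU : (T.biUnion id).card < k + T.card) (hn : k + T.card ≤ n + 1) :
    minDistance C + k + T.card ≤ n + 1 := by
  classical
  have hkle : k ≤ n := by simpa [hk] using Submodule.finrank_le C
  have : Nonempty (Fin n) := ⟨⟨0, by omega⟩⟩
  choose! p hpG hpu using hp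
  have hinj : Set.InjOn p T := fun G hG G' hG' e => hpu G' hG' G hG (by
    rw [← e]; exact hpG G hG)
  have hcardP : (T.image p).card = T.card := Finset.card_image_of_injOn hinj
  have hPU : T.image p ⊆ T.biUnion id := by
    intro x hx
    obtain ⟨G, hG, rfl⟩ := Finset.mem_image.mp hx
    exact Finset.mem_biUnion.mpr ⟨G, hG, hpG G hG⟩
  have h1 := Finset.card_sdiff_add_card_eq_card hPU
  have h2 : (T.image p)ᶜ.card = n - T.card := by
    rw [Finset.card_compl, hcardP, Fintype.card_fin]
  -- Room for `k - 1` points: the union without one private point per group has fewer than `k`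
  -- elements, and the complement of the private points has `n - #T ≥ k - 1`.
  obtain ⟨V, hV1, hV2, hV3⟩ := Finset.exists_subsuperset_card_eq
    (s := T.biUnion id \ T.image p) (t := (T.image p)ᶜ) (n := k - 1)
    (fun x hx => by simp only [Finset.mem_sdiff] at hx; simpa using hx.2)
    (by omega) (by omega)
  obtain ⟨c, hc, hc0, hcV⟩ := exists_codeword_vanishing C V (by omega)
  have hcP : ∀ x ∈ T.image p, c x = 0 := by
    intro x hx
    obtain ⟨G, hG, rfl⟩ := Finset.mem_image.mp hx
    refine hT G hG _ (hpG G hG) c hc fun j hj hjp => hcV j (hV1 ?_)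
    refine Finset.mem_sdiff.mpr ⟨Finset.mem_biUnion.mpr ⟨G, hG, hj⟩, fun hjP => hjp ?_⟩
    obtain ⟨G', hG', rfl⟩ := Finset.mem_image.mp hjP
    rw [hpu G' hG' G hG hj]
  have hdisj : Disjoint V (T.image p) := Finset.disjoint_left.mpr fun x hx hx' =>
    Finset.mem_compl.mp (hV2 hx) hx'
  have hw : hammingNorm c ≤ (V ∪ T.image p)ᶜ.card := by
    refine Finset.card_le_card fun x hx => ?_
    simp only [Finset.mem_filter, Finset.mem_univ, true_and] at hx
    rw [Finset.mem_compl, Finset.mem_union]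
    rintro (h | h)
    · exact hx (hcV x h)
    · exact hx (hcP x h)
  rw [Finset.card_compl, Finset.card_union_of_disjoint hdisj, hV3, hcardP, Fintype.card_fin] at hw
  have := minDistance_le_hammingNorm hc hc0
  have h3 := Finset.card_le_univ (T.image p)
  rw [hcardP, Fintype.card_fin] at h3
  omega

/-! ### Upper bounds on the minimum distance -/

/-- A point in at least two sets is counted twice by the sizes; a point in a single set is counted
once there and once among the private points. -/
theorem two_mul_card_biUnion_le {α : Type} [DecidableEq α] (T : Finset (Finset α)) :
    2 * (T.biUnion id).card ≤
      ∑ G ∈ T, ((T.biUnion id) \ ((T.erase G).biUnion id)).card + ∑ G ∈ T, G.card := by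
  classical
  have hA : ∀ G ∈ T, ((T.biUnion id) \ ((T.erase G).biUnion id)).card + G.card =
      ∑ x ∈ T.biUnion id,
        ((if x ∈ (T.erase G).biUnion id then 0 else 1) + if x ∈ G then 1 else 0) := by
    intro G hG
    rw [Finset.sum_add_distrib]
    congr 1
    · rw [Finset.sdiff_eq_filter, Finset.card_filter]
      exact Finset.sum_congr rfl fun x _ => by split_ifs <;> simp_all
    · rw [← Finset.card_filter, Finset.filter_mem_eq_inter,
        Finset.inter_eq_right.mpr (show G ⊆ T.biUnion id from Finset.subset_biUnion_of_mem id hG)]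
  rw [← Finset.sum_add_distrib, Finset.sum_congr rfl hA, Finset.sum_comm, mul_comm,
    ← smul_eq_mul, ← Finset.sum_const]
  refine Finset.sum_le_sum fun x hx => ?_
  obtain ⟨G, hG, hxG⟩ := Finset.mem_biUnion.mp hx
  simp only [id] at hxG
  by_cases hx' : x ∈ (T.erase G).biUnion id
  · obtain ⟨G', hG', hxG'⟩ := Finset.mem_biUnion.mp hx'
    simp only [id] at hxG'
    obtain ⟨hne, hG'T⟩ := Finset.mem_erase.mp hG'
    rw [← Finset.add_sum_erase _ _ hG]
    have := Finset.single_le_sum (f := fun G => ((if x ∈ (T.erase G).biUnion id then 0 else 1) +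
      if x ∈ G then 1 else 0 : ℕ)) (fun _ _ => Nat.zero_le _) hG'
    simp only [hxG, hxG', if_true] at this ⊢
    omega
  · have := Finset.single_le_sum (f := fun G => ((if x ∈ (T.erase G).biUnion id then 0 else 1) +
      if x ∈ G then 1 else 0 : ℕ)) (fun _ _ => Nat.zero_le _) hG
    simp only [hxG, hx', if_true, if_false] at this
    exact this

/-- An irredundant cover of the coordinates by repair groups of size at most `r + 1`. -/
theorem HasLocality.exists_cover {F : Type} [Field F] {n r : ℕ}
    {C : Submodule F (Fin n → F)} (h : HasLocality C r) :
    ∃ T : Finset (Finset (Fin n)), (∀ G ∈ T, G.card ≤ r + 1 ∧ IsRepairGroup C G) ∧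
      (∀ G ∈ T, ∃ p ∈ G, ∀ G' ∈ T, p ∈ G' → G' = G) ∧ n ≤ T.card * (r + 1) := by
  obtain ⟨T, h1, h2, h3⟩ := exists_irredundant_cover _ h.exists_isRepairGroup
  refine ⟨T, h1, h3, ?_⟩
  have hU : T.biUnion id = Finset.univ :=
    Finset.eq_univ_of_forall fun i => Finset.mem_biUnion.mpr (h2 i)
  simpa [hU] using Finset.card_biUnion_le_card_mul T id (r + 1) fun G hG => (h1 G hG).1

/-- The Singleton-like bound, for `k ≤ k₁ r < k + r` and `n` larger than `(k₁ - 1) (r + 1)`. -/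
theorem IsLRC.minDistance_add_le {F : Type} [Field F] [DecidableEq F] {n k r s : ℕ}
    {C : Submodule F (Fin n → F)} (hC : IsLRC C k r) (hs : s * r < k)
    (hn : s * (r + 1) ≤ n) (hkn : k + s ≤ n + 1) :
    minDistance C + k + s ≤ n + 1 := by
  obtain ⟨T, h1, h2, h3⟩ := hC.locality.exists_cover
  have hcard : s ≤ T.card := Nat.le_of_mul_le_mul_right (hn.trans h3) (Nat.succ_pos r)
  obtain ⟨S, hST, rfl⟩ := Finset.exists_subset_card_eq hcard
  refine minDistance_add_le_of_repairGroups hC.finrank_eq (by omega) S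
    (fun G hG => (h1 G (hST hG)).2) (fun G hG => ?_) ?_ hkn
  · obtain ⟨p, hp, hu⟩ := h2 G (hST hG)
    exact ⟨p, hp, fun G' hG' => hu G' (hST hG')⟩
  · have := Finset.card_biUnion_le_card_mul S id (r + 1) fun G hG => (h1 G (hST hG)).1
    have e : S.card * (r + 1) = S.card * r + S.card := by ring
    omega

/-- If the minimum distance exceeds `n - k - s + 1`, then any `s` groups of an irredundant cover
have a large union, which by double counting over `s + 1` groups bounds the parameters. -/
theorem IsLRC.mul_le_of_lt_minDistance {F : Type} [Field F] [DecidableEq F] {n k r s : ℕ}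
    {C : Submodule F (Fin n → F)} (hC : IsLRC C k r) (hk : 1 ≤ k) (hs : 1 ≤ s)
    (hn : s * (r + 1) < n) (hkn : k + s ≤ n + 1) (hd : n + 1 < minDistance C + k + s) :
    (s + 1) * (k + s) ≤ (s - 1) * n + (s + 1) * (r + 1) := by
  classical
  obtain ⟨T, h1, h2, h3⟩ := hC.locality.exists_cover
  have hcard : s < T.card := Nat.lt_of_mul_lt_mul_right (hn.trans_le h3)
  obtain ⟨S, hST, hS⟩ := Finset.exists_subset_card_eq (Nat.succ_le_of_lt hcard)
  have hlow : ∀ G ∈ S, k + s ≤ ((S.erase G).biUnion id).card := by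
    intro G hG
    by_contra! hlt
    have hce : (S.erase G).card = s := by rw [Finset.card_erase_of_mem hG, hS]; rfl
    have hsub : ∀ G' ∈ S.erase G, G' ∈ T := fun G' hG' => hST (Finset.mem_of_mem_erase hG')
    have := minDistance_add_le_of_repairGroups hC.finrank_eq hk (S.erase G)
      (fun G' hG' => (h1 G' (hsub G' hG')).2)
      (fun G' hG' => by
        obtain ⟨p, hp, hu⟩ := h2 G' (hsub G' hG')
        exact ⟨p, hp, fun G'' hG'' => hu G'' (hsub G'' hG'')⟩)
      (by rw [hce]; exact hlt) (by rw [hce]; exact hkn)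
    omega
  have hU : (S.biUnion id).card ≤ n := by
    simpa using Finset.card_le_univ (S.biUnion id)
  have hpriv : ∀ G ∈ S, ((S.biUnion id) \ ((S.erase G).biUnion id)).card + (k + s) ≤
      (S.biUnion id).card := by
    intro G hG
    have := Finset.card_sdiff_add_card_eq_card
      (Finset.biUnion_subset_biUnion_of_subset_left id (Finset.erase_subset G S))
    have := hlow G hG
    omega
  have hsum := Finset.sum_le_sum hpriv
  have hsz := Finset.sum_le_card_nsmul S Finset.card (r + 1) fun G hG => (h1 G (hST hG)).1
  rw [Finset.sum_add_distrib] at hsum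
  simp only [Finset.sum_const, hS, smul_eq_mul] at hsum hsz
  have hdc := two_mul_card_biUnion_le S
  obtain ⟨t, rfl⟩ : ∃ t, s = t + 1 := ⟨s - 1, by omega⟩
  rw [Nat.add_sub_cancel]
  have hm := Nat.mul_le_mul_left t hU
  simp only [Nat.succ_eq_add_one] at hsum hsz
  nlinarith

/-! ### Generic subspaces over a large finite field -/

open scoped Pointwise in
/-- A vector space over a field with more than `#s` elements is not the union of the proper
subspaces indexed by `s`. -/
theorem Submodule.exists_forall_notMem_of_card_lt {F E ι : Type*} [Field F] [Finite F]
    [AddCommGroup E] [Module F E] [FiniteDimensional F E] (s : Finset ι)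
    (W : ι → Submodule F E) (hF : s.card < Nat.card F) (hW : ∀ i ∈ s, W i ≠ ⊤) :
    ∃ v, ∀ i ∈ s, v ∉ W i := by
  by_contra! h
  have hc : ⋃ i ∈ s, (0 : E) +ᵥ ((W i).toAddSubgroup : Set E) = Set.univ := by
    refine Set.eq_univ_of_forall fun v => ?_
    obtain ⟨i, hi, hv⟩ := h v
    simp only [zero_vadd, Set.mem_iUnion]
    exact ⟨i, hi, hv⟩
  -- B. H. Neumann's lemma: in a finite cover by cosets some subgroup has index at most the number
  -- of cosets, but a proper subspace has index at least `#F`.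
  obtain ⟨i, hi, -, hle⟩ := AddSubgroup.exists_index_le_card_of_leftCoset_cover hc
  have : Nontrivial (E ⧸ W i) := Submodule.Quotient.nontrivial_iff.mpr (hW i hi)
  have hidx : (W i).toAddSubgroup.index = Nat.card F ^ Module.finrank F (E ⧸ W i) :=
    Module.natCard_eq_pow_finrank (K := F) (V := E ⧸ W i)
  have := Nat.le_self_pow (Module.finrank_pos (R := F) (M := E ⧸ W i)).ne' (Nat.card F)
  omega

/-- Over a large enough finite field there is a `k`-dimensional subspace meeting trivially
finitely many given subspaces of codimension at least `k`. -/
theorem Submodule.exists_finrank_eq_forall_disjoint {F E ι : Type*} [Field F] [Finite F]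
    [AddCommGroup E] [Module F E] [FiniteDimensional F E] (s : Finset ι) (hs : s.Nonempty)
    (W : ι → Submodule F E) (hF : s.card < Nat.card F) (k : ℕ)
    (hW : ∀ i ∈ s, Module.finrank F (W i) + k ≤ Module.finrank F E) :
    ∃ C : Submodule F E, Module.finrank F C = k ∧ ∀ i ∈ s, Disjoint C (W i) := by
  induction k with
  | zero => exact ⟨⊥, by simp, fun i _ => disjoint_bot_left⟩
  | succ k ih =>
    obtain ⟨C, hCk, hCW⟩ := ih fun i hi => (Nat.le_succ _).trans (hW i hi)
    obtain ⟨v, hv⟩ := Submodule.exists_forall_notMem_of_card_lt s (fun i => W i ⊔ C) hF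
      fun i hi htop => by
        have h1 := Submodule.finrank_add_le_finrank_add_finrank (W i) C
        have h2 := hW i hi
        rw [htop, finrank_top] at h1
        omega
    obtain ⟨i₀, hi₀⟩ := hs
    have hvC : v ∉ C := fun h => hv i₀ hi₀ (Submodule.mem_sup_right h)
    have hv0 : v ≠ 0 := fun h => hvC (h ▸ C.zero_mem)
    refine ⟨C ⊔ Submodule.span F {v}, ?_, fun i hi => ?_⟩
    · have hinf : C ⊓ Submodule.span F {v} = ⊥ :=
        ((Submodule.disjoint_span_singleton' hv0).mpr hvC).eq_bot
      have := Submodule.finrank_sup_add_finrank_inf_eq C (Submodule.span F {v})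
      rw [hinf, finrank_bot, finrank_span_singleton hv0, hCk] at this
      exact this
    · rw [Submodule.disjoint_def]
      intro x hx hxW
      obtain ⟨c, hc, y, hy, rfl⟩ := Submodule.mem_sup.mp hx
      obtain ⟨a, rfl⟩ := Submodule.mem_span_singleton.mp hy
      by_cases ha : a = 0
      · subst ha
        rw [zero_smul, add_zero] at hxW ⊢
        exact Submodule.disjoint_def.mp (hCW i hi) c hc hxW
      · refine absurd ?_ (hv i hi)
        have : v = a⁻¹ • (c + a • v) - a⁻¹ • c := by
          rw [smul_add, add_sub_cancel_left, smul_smul, inv_mul_cancel₀ ha, one_smul]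
        rw [this]
        exact Submodule.sub_mem _ (Submodule.smul_mem _ _ (Submodule.mem_sup_left hxW))
          (Submodule.smul_mem _ _ (Submodule.mem_sup_right hc))

/-! ### Parity checks and ranks of their columns -/

/-- The parity checks of the groups `G j`; the coefficients are chosen so that the columns of two
coordinates lying in two common groups are not proportional. -/
def groupMatrix (p : ℕ) {m n : ℕ} (G : Fin m → Finset (Fin n)) :
    Matrix (Fin m) (Fin n) (ZMod p) :=
  fun j c => if c ∈ G j then ((c + j + 1 : ℕ) : ZMod p) else 0

theorem groupMatrix_ne_zero {p m n : ℕ} (hp : n + m ≤ p) {G : Fin m → Finset (Fin n)}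
    {j : Fin m} {c : Fin n} (hc : c ∈ G j) : groupMatrix p G j c ≠ 0 := by
  rw [groupMatrix, if_pos hc, Ne, ZMod.natCast_eq_zero_iff]
  intro h
  have := Nat.le_of_dvd (by omega) h
  omega

theorem groupMatrix_of_notMem {p m n : ℕ} {G : Fin m → Finset (Fin n)}
    {j : Fin m} {c : Fin n} (hc : c ∉ G j) : groupMatrix p G j c = 0 := if_neg hc

theorem ZMod.natCast_fin_injOn {p n : ℕ} (hp : n ≤ p) {u v : Fin n}
    (h : ((u : ℕ) : ZMod p) = ((v : ℕ) : ZMod p)) : u = v := by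
  rw [ZMod.natCast_eq_natCast_iff] at h
  exact Fin.ext (h.eq_of_lt_of_lt (u.2.trans_le hp) (v.2.trans_le hp))

/-- Two coordinates, one of which lies in two groups, have independent columns. -/
theorem eq_zero_of_mem_two_groups {p m n : ℕ} [Fact p.Prime] (hp : n + m ≤ p)
    {G : Fin m → Finset (Fin n)} (hcov : ∀ c, ∃ j, c ∈ G j) {u v : Fin n} (huv : u ≠ v)
    {a b : Fin m} (hab : a ≠ b) (ha : u ∈ G a) (hb : u ∈ G b) {y z : ZMod p}
    (h : ∀ j, groupMatrix p G j u * y + groupMatrix p G j v * z = 0) : y = 0 ∧ z = 0 := by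
  have key : y = 0 → y = 0 ∧ z = 0 := fun hy => by
    obtain ⟨j, hj⟩ := hcov v
    have := h j
    rw [hy, mul_zero, zero_add] at this
    exact ⟨hy, (mul_eq_zero.mp this).resolve_left (groupMatrix_ne_zero hp hj)⟩
  by_cases hva : v ∈ G a
  · by_cases hvb : v ∈ G b
    · apply key
      have e1 := h a
      have e2 := h b
      simp only [groupMatrix, if_pos ha, if_pos hb, if_pos hva, if_pos hvb] at e1 e2
      push_cast at e1 e2
      -- The 2 × 2 minor on rows `a`, `b` and columns `u`, `v` equals `(u - v) (b - a)`.
      have e3 : (((u : ℕ) : ZMod p) - ((v : ℕ) : ZMod p)) *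
          (((b : ℕ) : ZMod p) - ((a : ℕ) : ZMod p)) * y = 0 := by
        linear_combination (((v : ℕ) : ZMod p) + ((b : ℕ) : ZMod p) + 1) * e1 -
          (((v : ℕ) : ZMod p) + ((a : ℕ) : ZMod p) + 1) * e2
      refine (mul_eq_zero.mp e3).resolve_left (mul_ne_zero (sub_ne_zero.mpr fun e => huv ?_)
        (sub_ne_zero.mpr fun e => hab ?_))
      · exact ZMod.natCast_fin_injOn (by omega) e
      · exact (ZMod.natCast_fin_injOn (by omega) e).symm
    · have := h b
      rw [groupMatrix_of_notMem hvb, zero_mul, add_zero] at this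
      exact key ((mul_eq_zero.mp this).resolve_left (groupMatrix_ne_zero hp hb))
  · have := h a
    rw [groupMatrix_of_notMem hva, zero_mul, add_zero] at this
    exact key ((mul_eq_zero.mp this).resolve_left (groupMatrix_ne_zero hp ha))

/-- A set of coordinates not contained in the private part of a single group contains two
coordinates with independent columns. -/
theorem exists_pair_independent {p m n : ℕ} [Fact p.Prime] (hp : n + m ≤ p)
    {G : Fin m → Finset (Fin n)} (hcov : ∀ c, ∃ j, c ∈ G j) {A : Finset (Fin n)}
    (hA : 2 ≤ A.card)
    (hpriv : ∀ j, (Finset.univ.filter fun c => ∀ j', c ∈ G j' ↔ j' = j).card < A.card) :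
    ∃ u ∈ A, ∃ v ∈ A, u ≠ v ∧ ∀ y z : ZMod p,
      (∀ j, groupMatrix p G j u * y + groupMatrix p G j v * z = 0) → y = 0 ∧ z = 0 := by
  classical
  by_cases h2 : ∃ u ∈ A, ∃ a b, a ≠ b ∧ u ∈ G a ∧ u ∈ G b
  · obtain ⟨u, hu, a, b, hab, ha, hb⟩ := h2
    obtain ⟨v, hv, hvu⟩ := Finset.exists_mem_ne hA u
    exact ⟨u, hu, v, hv, hvu.symm, fun y z h =>
      eq_zero_of_mem_two_groups hp hcov hvu.symm hab ha hb h⟩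
  -- Now `A` has only private points and is too large for one group; points private to different
  -- groups have columns of disjoint support.
  · push Not at h2
    obtain ⟨u, hu⟩ : A.Nonempty := Finset.card_pos.mp (by omega)
    obtain ⟨a, ha⟩ := hcov u
    have huniq : ∀ w ∈ A, ∀ i j, w ∈ G i → w ∈ G j → i = j := fun w hw i j hi hj => by
      by_contra hne
      exact h2 w hw i j hne hi hj
    obtain ⟨v, hv, hva⟩ : ∃ v ∈ A, v ∉ G a := by
      by_contra! hall
      refine (Finset.card_le_card fun c hc => ?_).not_gt (hpriv a)
      refine Finset.mem_filter.mpr ⟨Finset.mem_univ _, fun j => ⟨fun hj => ?_, ?_⟩⟩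
      · exact huniq c hc j a hj (hall c hc)
      · rintro rfl
        exact hall c hc
    obtain ⟨b, hb⟩ := hcov v
    have hub : u ∉ G b := fun h => hva (huniq u hu b a h ha ▸ hb)
    refine ⟨u, hu, v, hv, fun e => hva (e ▸ ha), fun y z h => ⟨?_, ?_⟩⟩
    · have := h a
      rw [groupMatrix_of_notMem hva, zero_mul, add_zero] at this
      exact (mul_eq_zero.mp this).resolve_left (groupMatrix_ne_zero hp ha)
    · have := h b
      rw [groupMatrix_of_notMem hub, zero_mul, zero_add] at this
      exact (mul_eq_zero.mp this).resolve_left (groupMatrix_ne_zero hp hb)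

/-- The vectors of the kernel of `M` supported on `A` form a space of dimension at most `#A - 2`
when two of the columns indexed by `A` are independent. -/
theorem finrank_add_two_le_of_pair {F : Type} [Field F] {m n : ℕ}
    (M : Matrix (Fin m) (Fin n) F) (A : Finset (Fin n)) {u v : Fin n} (hu : u ∈ A) (hv : v ∈ A)
    (huv : u ≠ v) (h : ∀ y z : F, (∀ j, M j u * y + M j v * z = 0) → y = 0 ∧ z = 0)
    (W : Submodule F (LinearMap.ker M.mulVecLin)) (hW : ∀ x ∈ W, ∀ c ∉ A, x.1 c = 0) :
    Module.finrank F W + 2 ≤ A.card := by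
  classical
  let B : Finset (Fin n) := (A.erase u).erase v
  have hB : B.card + 2 = A.card := by
    have h1 : B.card + 1 = (A.erase u).card :=
      Finset.card_erase_add_one (Finset.mem_erase.mpr ⟨huv.symm, hv⟩)
    have h2 := Finset.card_erase_add_one hu
    omega
  let f : W →ₗ[F] (B → F) := (LinearMap.funLeft F F (fun i : B => (i : Fin n))) ∘ₗ
    (LinearMap.ker M.mulVecLin).subtype ∘ₗ W.subtype
  have hf : Function.Injective f := by
    rw [injective_iff_map_eq_zero]
    rintro ⟨⟨x, hx⟩, hxW⟩ hfx
    have hB0 : ∀ c, c ≠ u → c ≠ v → x c = 0 := fun c hcu hcv => by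
      by_cases hc : c ∈ A
      · exact congrFun hfx ⟨c, Finset.mem_erase.mpr ⟨hcv, Finset.mem_erase.mpr ⟨hcu, hc⟩⟩⟩
      · exact hW _ hxW c hc
    obtain ⟨hy, hz⟩ := h (x u) (x v) fun j => by
      have hj : ∑ c, M j c * x c = 0 := congrFun (LinearMap.mem_ker.mp hx) j
      rwa [Fintype.sum_eq_add u v huv fun c hc => by rw [hB0 c hc.1 hc.2, mul_zero]] at hj
    refine Subtype.ext (Subtype.ext (funext fun c => ?_))
    by_cases hcu : c = u
    · exact hcu ▸ hy
    · by_cases hcv : c = v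
      · exact hcv ▸ hz
      · exact hB0 c hcu hcv
  have := LinearMap.finrank_le_finrank_of_injective hf
  rw [Module.finrank_fintype_fun_eq_card, Fintype.card_coe] at this
  omega

/-! ### The code attached to a cover -/

/-- The subspace of vectors of `V` supported on `A`. -/
def supportedOn {F : Type} [Field F] {n : ℕ} (V : Submodule F (Fin n → F))
    (A : Finset (Fin n)) : Submodule F V where
  carrier := {x | ∀ c ∉ A, x.1 c = 0}
  add_mem' := fun {x y} hx hy c hc => by
    show x.1 c + y.1 c = 0
    rw [hx c hc, hy c hc, add_zero]
  zero_mem' := fun _ _ => rfl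
  smul_mem' := fun a x hx c hc => by
    show a * x.1 c = 0
    rw [hx c hc, mul_zero]

/-- A cover by `m` groups of size at most `r + 1`, each with fewer than `e` private elements, gives
a locally recoverable code all of whose nonzero words have weight more than `e`. -/
theorem exists_isLRC_of_groups {m n k r e : ℕ} (G : Fin m → Finset (Fin n))
    (hcov : ∀ c, ∃ j, c ∈ G j) (hG : ∀ j, (G j).card ≤ r + 1)
    (hpriv : ∀ j, (Finset.univ.filter fun c => ∀ j', c ∈ G j' ↔ j' = j).card < e)
    (he2 : 2 ≤ e) (hen : e ≤ n) (hek : e + k + m ≤ n + 2) :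
    ∃ (p : ℕ) (_ : Fact p.Prime) (C : Submodule (ZMod p) (Fin n → ZMod p)),
      IsLRC C k r ∧ ∀ c ∈ C, c ≠ 0 → e < hammingNorm c := by
  classical
  -- `n + m` keeps the matrix entries nonzero; the number of `e`-subsets is the number of subspaces
  -- to avoid.
  obtain ⟨p, hpge, hp⟩ := Nat.exists_infinite_primes
    (n + m + ((Finset.univ : Finset (Fin n)).powersetCard e).card + 1)
  have : Fact p.Prime := ⟨hp⟩
  let M := groupMatrix p G
  let V : Submodule (ZMod p) (Fin n → ZMod p) := LinearMap.ker M.mulVecLin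
  have hV : n ≤ Module.finrank (ZMod p) V + m := by
    have h1 := LinearMap.finrank_range_add_finrank_ker M.mulVecLin
    have h2 := Submodule.finrank_le (LinearMap.range M.mulVecLin)
    simp only [Module.finrank_fintype_fun_eq_card, Fintype.card_fin] at h1 h2
    have h3 : Module.finrank (ZMod p) V =
      Module.finrank (ZMod p) (LinearMap.ker M.mulVecLin) := rfl
    omega
  obtain ⟨D, hDk, hD⟩ := Submodule.exists_finrank_eq_forall_disjoint
    ((Finset.univ : Finset (Fin n)).powersetCard e)
    (Finset.powersetCard_nonempty.mpr (by simpa using hen)) (supportedOn V)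
    (by rw [Nat.card_zmod]; omega) k (fun A hA => by
      have hAe := (Finset.mem_powersetCard.mp hA).2
      obtain ⟨u, hu, v, hv, huv, h⟩ := exists_pair_independent (p := p) (by omega) hcov
        (A := A) (by omega) (by rw [hAe]; exact hpriv)
      have : Module.finrank (ZMod p) (supportedOn V A) + 2 ≤ A.card :=
        finrank_add_two_le_of_pair M A hu hv huv h (supportedOn V A) fun x hx => hx
      omega)
  refine ⟨p, ⟨hp⟩, D.map V.subtype, ⟨?_, fun i => ?_⟩, ?_⟩
  · rw [← hDk]
    exact (Submodule.equivMapOfInjective _ V.injective_subtype D).finrank_eq.symm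
  · obtain ⟨j, hj⟩ := hcov i
    refine ⟨(G j).erase i, Finset.notMem_erase _ _, ?_, fun c => -(M j i)⁻¹ * M j c, ?_⟩
    · rw [Finset.card_erase_of_mem hj]
      have := hG j
      omega
    · rintro _ ⟨⟨x, hx⟩, -, rfl⟩
      have hne : M j i ≠ 0 := groupMatrix_ne_zero (by omega) hj
      have hsum : ∑ c, M j c * x c = 0 := congrFun (LinearMap.mem_ker.mp hx) j
      rw [← Finset.sum_subset (Finset.subset_univ (G j)) fun c _ hc => by
        rw [show M j c = 0 from groupMatrix_of_notMem hc, zero_mul],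
        ← Finset.add_sum_erase _ _ hj] at hsum
      simp only [Submodule.subtype_apply, mul_assoc]
      rw [← Finset.mul_sum, eq_neg_of_add_eq_zero_right hsum]
      field_simp
  · rintro _ ⟨x, hx, rfl⟩ hx0
    by_contra! hle
    obtain ⟨A, hsub, -, hA⟩ := Finset.exists_subsuperset_card_eq
      (Finset.subset_univ (Finset.univ.filter fun i => x.1 i ≠ 0)) hle (by simpa using hen)
    have hxA : x ∈ supportedOn V A := fun c hc => by
      by_contra hne
      exact hc (hsub (by simpa using hne))
    have := Submodule.disjoint_def.mp
      (hD A (Finset.mem_powersetCard.mpr ⟨Finset.subset_univ _, hA⟩)) x hx hxA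
    exact hx0 (by rw [this]; rfl)

/-! ### An even distribution of coordinates among groups -/

/-- The `m (r + 1) = n + N` slots `t` are dealt cyclically to the groups `t % m`; the slots `2 c`
and `2 c + 1` both hold the coordinate `c < N`, and the slot `c + N` holds the coordinate
`c ≥ N`. -/
def cyclicGroup (m n N : ℕ) (j : Fin m) : Finset (Fin n) :=
  Finset.univ.filter fun c =>
    (c < N ∧ (2 * c % m = j ∨ (2 * c + 1) % m = j)) ∨ (N ≤ c ∧ (c + N) % m = j)

theorem mem_cyclicGroup {m n N : ℕ} {j : Fin m} {c : Fin n} : c ∈ cyclicGroup m n N j ↔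
    ((c : ℕ) < N ∧ (2 * c % m = j ∨ (2 * c + 1) % m = j)) ∨ (N ≤ (c : ℕ) ∧ (c + N) % m = j) := by
  simp [cyclicGroup]

theorem exists_mem_cyclicGroup {m n N : ℕ} (hm : 0 < m) (c : Fin n) :
    ∃ j, c ∈ cyclicGroup m n N j := by
  simp only [mem_cyclicGroup]
  by_cases h : (c : ℕ) < N
  · exact ⟨⟨2 * c % m, Nat.mod_lt _ hm⟩, Or.inl ⟨h, Or.inl rfl⟩⟩
  · exact ⟨⟨(c + N) % m, Nat.mod_lt _ hm⟩, Or.inr ⟨by omega, rfl⟩⟩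

/-- Slots of one residue class below `m (r + 1)` are told apart by their quotients by `m`, which lie
below `r + 1`. -/
theorem card_cyclicGroup_le {m n N r : ℕ} (hN : N ≤ n) (h : n + N = m * (r + 1)) (j : Fin m) :
    (cyclicGroup m n N j).card ≤ r + 1 := by
  classical
  have hs : ∀ c ∈ cyclicGroup m n N j, ∃ t, t % m = j ∧
      (((c : ℕ) < N ∧ (t = 2 * c ∨ t = 2 * c + 1)) ∨ (N ≤ (c : ℕ) ∧ t = c + N)) := by
    intro c hc
    rcases mem_cyclicGroup.mp hc with ⟨h1, h2 | h2⟩ | ⟨h1, h2⟩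
    · exact ⟨_, h2, Or.inl ⟨h1, Or.inl rfl⟩⟩
    · exact ⟨_, h2, Or.inl ⟨h1, Or.inr rfl⟩⟩
    · exact ⟨_, h2, Or.inr ⟨h1, rfl⟩⟩
  choose! t ht hct using hs
  rw [← Finset.card_range (r + 1)]
  refine Finset.card_le_card_of_injOn (fun c => t c / m) (fun c hc => ?_) fun c hc d hd hcd => ?_
  · have hc' := hct c hc
    have := c.2
    simp only [Finset.coe_range, Set.mem_Iio]
    rw [Nat.div_lt_iff_lt_mul (Fin.pos j), mul_comm, ← h]
    omega
  · have e : t c = t d := by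
      rw [← Nat.div_add_mod (t c) m, ← Nat.div_add_mod (t d) m, ht c hc, ht d hd]
      simp only at hcd
      rw [hcd]
    have h1 := hct c hc
    have h2 := hct d hd
    exact Fin.ext (by omega)

/-- The slots `2 c`, `2 c + 1` of a coordinate `c < N` have different residues, so private
coordinates sit in slots at or beyond `2 N`, with quotients in `[2 N / m, r + 1)`. -/
theorem card_private_cyclicGroup_le {m n N r : ℕ} (hm : 2 ≤ m) (h : n + N = m * (r + 1))
    (j : Fin m) : (Finset.univ.filter fun c => ∀ j', c ∈ cyclicGroup m n N j' ↔ j' = j).card ≤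
      r + 1 - 2 * N / m := by
  classical
  have hpr : ∀ c ∈ Finset.univ.filter fun c => ∀ j', c ∈ cyclicGroup m n N j' ↔ j' = j,
      N ≤ (c : ℕ) ∧ ((c : ℕ) + N) % m = j := by
    intro c hc
    have hc := (Finset.mem_filter.mp hc).2
    rcases mem_cyclicGroup.mp ((hc j).mpr rfl) with ⟨h1, -⟩ | h2
    · exfalso
      have e1 := (hc ⟨2 * c % m, Nat.mod_lt _ (by omega)⟩).mp
        (mem_cyclicGroup.mpr (Or.inl ⟨h1, Or.inl rfl⟩))
      have e2 := (hc ⟨(2 * c + 1) % m, Nat.mod_lt _ (by omega)⟩).mp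
        (mem_cyclicGroup.mpr (Or.inl ⟨h1, Or.inr rfl⟩))
      have e3 : 2 * (c : ℕ) + 0 ≡ 2 * c + 1 [MOD m] := Fin.val_eq_of_eq (e1.trans e2.symm)
      have e4 := (Nat.ModEq.add_left_cancel' _ e3).eq_of_lt_of_lt (by omega) (by omega)
      omega
    · exact h2
  rw [← Nat.card_Ico]
  refine Finset.card_le_card_of_injOn (fun c => ((c : ℕ) + N) / m) (fun c hc => ?_)
    fun c hc d hd hcd => ?_
  · obtain ⟨h1, -⟩ := hpr c hc
    have := c.2
    simp only [Finset.coe_Ico, Set.mem_Ico]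
    refine ⟨Nat.div_le_div_right (by omega), ?_⟩
    rw [Nat.div_lt_iff_lt_mul (by omega), mul_comm, ← h]
    omega
  · have e : (c : ℕ) + N = d + N := by
      rw [← Nat.div_add_mod ((c : ℕ) + N) m, ← Nat.div_add_mod ((d : ℕ) + N) m,
        (hpr c hc).2, (hpr d hd).2]
      simp only at hcd
      rw [hcd]
    exact Fin.ext (by omega)

/-! ### The criterion in natural numbers and its translation -/

theorem largestMinDistance_eq_iff {n k r s K N : ℕ} (hr : 1 ≤ r) (hrk : r ≤ k)
    (hK : k + K = s * r) (hKr : K < r) (hN : n + N = (s + 1) * (r + 1)) (hNr : N ≤ r) :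
    largestMinDistance n k r = r + 3 + K - N ↔ N ≤ K + 2 * N / (s + 1) := by
  obtain ⟨t, rfl⟩ : ∃ t, s = t + 1 := by
    refine Nat.exists_eq_succ_of_ne_zero ?_
    rintro rfl
    omega
  have e1 : (t + 1) * r = t * r + r := by ring
  have e2 : (t + 1 + 1) * (r + 1) = t * r + t + 2 * r + 2 := by ring
  have e3 : (t + 1) * (r + 1) = t * r + t + r + 1 := by ring
  have e4 : t * (r + 1) = t * r + t := by ring
  rw [e1] at hK
  constructor
  · intro h
    -- Without any code the supremum would be the default `0`, whereas `r + 3 + K - N > 0`.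
    have hne : (lrcDistances n k r).Nonempty := by
      by_contra hempty
      rw [Set.not_nonempty_iff_eq_empty] at hempty
      rw [largestMinDistance, hempty, csSup_empty, Nat.bot_eq_zero] at h
      omega
    obtain ⟨F, _, _, _, C, hC, hd⟩ := (isGreatest_largestMinDistance hne).1
    have := hC.mul_le_of_lt_minDistance (s := t + 1) (by omega) (by omega) (by omega)
      (by omega) (by omega)
    rw [Nat.add_sub_cancel] at this
    have h1 : (t + 2) * N ≤ (t + 2) * K + 2 * N := by
      have hk : (k : ℤ) = t * r + r - K := by omega
      have hn : (n : ℤ) = t * r + t + 2 * r + 2 - N := by omega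
      zify at this ⊢
      rw [hk, hn] at this
      nlinarith
    rw [← Nat.sub_le_iff_le_add', Nat.le_div_iff_mul_le (by omega), Nat.sub_mul]
    have h2 : N * (t + 1 + 1) = (t + 2) * N := by ring
    have h3 : K * (t + 1 + 1) = (t + 2) * K := by ring
    omega
  · intro h
    -- Here `e = d* - 1`, for which `e + k + m = n + 2` with `m = t + 2`; the hypothesis `h` says
    -- exactly that the private parts are smaller than `e`.
    obtain ⟨p, hp, C, hC, hw⟩ := exists_isLRC_of_groups (k := k) (r := r) (e := r + 2 + K - N)
      (cyclicGroup (t + 1 + 1) n N) (exists_mem_cyclicGroup (by omega))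
      (card_cyclicGroup_le (by omega) hN)
      (fun j => by
        have := card_private_cyclicGroup_le (by omega) hN j
        omega)
      (by omega) (by omega) (by omega)
    have hbound : ∀ d ∈ lrcDistances n k r, d ≤ r + 3 + K - N := by
      rintro _ ⟨F, _, _, _, D, hD, rfl⟩
      have := hD.minDistance_add_le (s := t) (by omega) (by omega) (by omega)
      omega
    have hC0 : C ≠ ⊥ := by
      rintro rfl
      have := hC.finrank_eq
      rw [finrank_bot] at this
      omega
    have hle := le_minDistance hC0 (d := r + 3 + K - N) fun c hc h0 => by
      have := hw c hc h0
      omega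
    have hmem : minDistance C ∈ lrcDistances n k r :=
      ⟨ZMod p, inferInstance, inferInstance, inferInstance, C, hC, rfl⟩
    exact le_antisymm (hbound _ (isGreatest_largestMinDistance ⟨_, hmem⟩).1)
      (hle.trans ((isGreatest_largestMinDistance ⟨_, hmem⟩).2 hmem))

theorem ceil_div_bounds (a : ℕ) {b : ℕ} (hb : 0 < b) :
    (a : ℤ) ≤ ⌈(a : ℚ) / b⌉ * b ∧ ⌈(a : ℚ) / b⌉ * b < (a : ℤ) + b := by
  have hb' : (0 : ℚ) < b := by exact_mod_cast hb
  have h1 := (div_le_iff₀ hb').mp (Int.le_ceil ((a : ℚ) / b))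
  have h2 : (⌈(a : ℚ) / b⌉ : ℚ) * b < ((a : ℚ) / b + 1) * b :=
    mul_lt_mul_of_pos_right (Int.ceil_lt_add_one _) hb'
  rw [add_mul, div_mul_cancel₀ _ hb'.ne', one_mul] at h2
  exact ⟨by exact_mod_cast h1, by exact_mod_cast h2⟩

theorem mainTheorem6 (n k r : ℕ) (hr : 1 ≤ r) (hrk : r ≤ k) (hkn : k < n)
    (h : paramN₁ n r - paramK₁ k r = 1) :
    (largestMinDistance n k r : ℤ) = dStar n k r ↔
      paramN₂ n r - ⌊(2 * paramN₂ n r : ℚ) / (paramN₁ n r : ℚ)⌋ ≤ paramK₂ k r := by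
  obtain ⟨hk1, hk2⟩ := ceil_div_bounds k (Nat.lt_of_lt_of_le Nat.zero_lt_one hr)
  obtain ⟨hn1, hn2⟩ := ceil_div_bounds n (Nat.succ_pos r)
  rw [Nat.cast_succ, Nat.cast_succ] at hn1 hn2
  have hdS : dStar n k r = n - k - paramK₁ k r + 2 := rfl
  change (k : ℤ) ≤ paramK₁ k r * r at hk1
  change paramK₁ k r * r < (k : ℤ) + r at hk2
  change (n : ℤ) ≤ paramN₁ n r * (r + 1) at hn1
  change paramN₁ n r * (r + 1) < (n : ℤ) + (r + 1) at hn2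
  have hN1 : paramN₁ n r = paramK₁ k r + 1 := by omega
  have hpos : 0 ≤ paramK₁ k r := Int.ceil_nonneg (by positivity)
  obtain ⟨s, hs⟩ := Int.eq_ofNat_of_zero_le hpos
  obtain ⟨K, hK⟩ := Int.eq_ofNat_of_zero_le (sub_nonneg.mpr hk1)
  obtain ⟨N, hN⟩ := Int.eq_ofNat_of_zero_le (sub_nonneg.mpr hn1)
  have hK2 : paramK₂ k r = K := hK
  have hN2 : paramN₂ n r = N := hN
  rw [hdS, hK2, hN2, hN1, hs]
  rw [hN1, hs] at hN hn2
  rw [hs] at hK hk2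
  have hK' : k + K = s * r := by zify; linarith
  have hN' : n + N = (s + 1) * (r + 1) := by zify; linarith
  have hKr : K < r := by zify; linarith
  have hNr : N ≤ r := by
    refine Nat.le_of_lt_succ ?_
    zify
    linarith
  have hfl : ⌊(2 * ((N : ℤ) : ℚ)) / (((s : ℤ) + 1 : ℤ) : ℚ)⌋ = ((2 * N / (s + 1) : ℕ) : ℤ) := by
    have := Rat.floor_intCast_div_natCast (2 * N : ℤ) (s + 1)
    push_cast at this ⊢
    exact this
  have hkey := largestMinDistance_eq_iff hr hrk hK' hKr hN' hNr
  rw [hfl, sub_le_iff_le_add, ← Nat.cast_add, Nat.cast_le, ← hkey]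
  have e : (s + 1) * (r + 1) = s * r + s + r + 1 := by ring
  omega
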